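/- Let $n\ge 2$, let $\mathcal L=\{<_1,\dots,<_n\}$ be the language with $n$ binary relation symbols, and let $M_n$ be the universal $n$-linear order, i.e. the (countable) Fraïssé limit of the class of all finite $\mathcal L$-structures in which every $<_i$ is a strict linear order. For $I\subseteq\{1,\dots,n\}$ let $M_n^I$ be the structure obtained from $M_n$ by reversing the order $<_i$ for every $i\in I$; it has the same automorphisms as $M_n$. For an automorphism $f$ and one of the linear orders $<$ of $M_n^I$, the orbital of $f$ containing a point $a$ is the set of all $b$ with $f^k a\le b\le f^l a$ for some $k,l\in\mathbb Z$. We say that $f$ has a single $+$-orbital with respect to $<$ if there is a point $a$ such that the sequence $(f^i a)_{i\in\mathbb Z}$ is unbounded above and below with respect to $<$ and $f b>b$ for every $b$ in the orbital of $f$ containing $a$. Let $g\in\mathrm{Aut}(M_n)$ with $g\neq 1$. Then there exist an automorphism $f\in\mathrm{Aut}(M_n)$, which is a product of finitely many conjugates (in $\mathrm{Aut}(M_n)$) of $g$ and $g^{-1}$, and a set $I\subseteq\{1,\dots,n\}$ such that, for every $j\in\{1,\dots,n\}$, $f$ has a single $+$-orbital with respect to the order $<_j$ of $M_n^I$. 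-/

import Mathlib

open scoped FirstOrder

universe w

/-- The relation symbols of the language with `n` binary relation symbols `<₁, …, <ₙ`
(indexed by `Fin n`) and no others. -/
inductive NOrderRel (n : ℕ) : ℕ → Type
  | lt (i : Fin n) : NOrderRel n 2

/-- The relational language `{<₁, …, <ₙ}`. -/
abbrev nOrderLang (n : ℕ) : FirstOrder.Language.{0, 0} := ⟨fun _ => Empty, NOrderRel n⟩

/-- The binary relation `<ᵢ` of a `{<₁, …, <ₙ}`-structure `S` on `M`. The structure is an explicit
argument because several structures on the same set are considered. -/
def nLt {n : ℕ} {M : Type*} (S : (nOrderLang n).Structure M) (i : Fin n) (x y : M) : Prop :=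
  S.RelMap (NOrderRel.lt i) ![x, y]

/-- The class of all finite `{<₁, …, <ₙ}`-structures in which every `<ᵢ` is a (strict) linear
order. -/
def finiteNOrders (n : ℕ) : Set (CategoryTheory.Bundled.{w} (nOrderLang n).Structure) :=
  {A | Finite A ∧ ∀ i : Fin n, IsStrictTotalOrder A (nLt A.str i)}

/-- `M` is (a copy of) the universal `n`-linear order: it is the Fraïssé limit of the class of
finite sets with `n` linear orders. -/
abbrev IsUniversalNOrder (n : ℕ) (M : Type w) [(nOrderLang n).Structure M] [Countable M] : Prop :=
  FirstOrder.Language.IsFraisseLimit (finiteNOrders.{w} n) M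

/-- The structure on the same set with `<ᵢ` reversed for every `i ∈ I`. -/
abbrev reverseOrders {n : ℕ} {M : Type*} (S : (nOrderLang n).Structure M) (I : Set (Fin n)) :
    (nOrderLang n).Structure M where
  funMap := fun f _ => f.elim
  RelMap := fun r v => match r, v with
    | .lt i, v => (i ∉ I ∧ nLt S i (v 0) (v 1)) ∨ (i ∈ I ∧ nLt S i (v 1) (v 0))

/-- The automorphisms of a first-order structure form a group under composition. -/
instance autGroup {L : FirstOrder.Language} {M : Type*} [L.Structure M] : Group (M ≃[L] M) where
  mul f g := f.comp g
  one := FirstOrder.Language.Equiv.refl L M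
  inv f := f.symm
  mul_assoc _ _ _ := rfl
  one_mul f := FirstOrder.Language.Equiv.refl_comp f
  mul_one f := FirstOrder.Language.Equiv.comp_refl f
  inv_mul_cancel f := FirstOrder.Language.Equiv.symm_comp_self f

/-- `f` is a product of (finitely many) conjugates of `g` and `g⁻¹` in the group `G`. -/
def IsProductOfConjugates {G : Type*} [Group G] (g f : G) : Prop :=
  ∃ l : List G, (∀ k ∈ l, ∃ h : G, k = h * g * h⁻¹ ∨ k = h * g⁻¹ * h⁻¹) ∧ l.prod = f

/-- The convexification of `S` with respect to a strict linear order `lt`. -/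
def convexification {M : Type*} (lt : M → M → Prop) (S : Set M) : Set M :=
  {a | ∃ s₁ ∈ S, ∃ s₂ ∈ S, (s₁ = a ∨ lt s₁ a) ∧ (a = s₂ ∨ lt a s₂)}

/-- The orbital of `f` containing `a`: the convexification of `{fⁱ a | i ∈ ℤ}`. -/
def orbital {M : Type*} (lt : M → M → Prop) (f : Equiv.Perm M) (a : M) : Set M :=
  convexification lt (Set.range fun i : ℤ => (f ^ i) a)

/-- `f` has a single `+`-orbital with respect to the strict linear order `lt`: for some point `a`,
the sequence `(fⁱ a)`, `i ∈ ℤ`, is unbounded above and below, and the orbital of `f`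
containing `a` is a `+`-orbital, that is, `f` moves each of its points up. -/
def HasSinglePlusOrbital {M : Type*} (lt : M → M → Prop) (f : Equiv.Perm M) : Prop :=
  ∃ a : M, (∀ x : M, ∃ i : ℤ, lt x ((f ^ i) a)) ∧ (∀ x : M, ∃ i : ℤ, lt ((f ^ i) a) x) ∧
    ∀ b ∈ orbital lt f a, lt b (f b)

/-! The set `I` can always be taken empty, with `f` a product of four conjugates of `g` and `g⁻¹`.
The only property of the limit that is used is genericity: nonempty open intervals, one per order,
have a common point.

A nontrivial `g` moves every point strictly between `a` and `g a` in one order. As `n ≥ 2`,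
genericity finds such moved points arbitrarily far out at either end of any prescribed order.
Back-and-forth then builds `k` with `k x < x` and `g x < k (g x)` for suitable `x` far out at both
ends of each order. At `g x` the commutator `g k⁻¹ g⁻¹ k` moves up (`exists_commutator_far`),
whatever it does elsewhere.

Write `f₀` for this commutator. Each order is cut into open convex pieces indexed by `ℤ`, with
points `c m` in piece `2m` whose `f₀`-images lie in piece `2m + 2`. A labelled back-and-forth
(`exists_perm`) gives `e` shifting all these labels by one in all orders at once. The upward jumps
of `e f₀ e⁻¹` then interleave with those of `f₀`, so `f₀ (e f₀ e⁻¹)` sends `e (c m)` above `e (c (m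
+ 1))`. This climbing sequence is unbounded both ways, which forces a single `+`-orbital. -/

/-- A family of strict linear orders without endpoints such that nonempty open intervals, one for
each of the orders, always have a common point. -/
structure IsGenericOrderFamily {n : ℕ} {M : Type*} (lt : Fin n → M → M → Prop) : Prop where
  strictTotal : ∀ i, IsStrictTotalOrder M (lt i)
  exists_gt : ∀ i x, ∃ y, lt i x y
  exists_lt : ∀ i x, ∃ y, lt i y x
  between : ∀ a b : Fin n → M, (∀ i, lt i (a i) (b i)) → ∃ x, ∀ i, lt i (a i) x ∧ lt i x (b i)

/-! ### Genericity of the Fraïssé limit -/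

/-- The order on `Option A` extending an order on `A`, in which `none` is placed just above the
initial segment `D`. -/
def optionLt {A : Type*} (r : A → A → Prop) (D : Set A) : Option A → Option A → Prop
  | some a, some b => r a b
  | some a, none => a ∈ D
  | none, some b => b ∉ D
  | none, none => False

theorem isStrictTotalOrder_optionLt {A : Type*} (r : A → A → Prop) [h : IsStrictTotalOrder A r]
    (D : Set A) (hD : ∀ a b, r a b → b ∈ D → a ∈ D) :
    IsStrictTotalOrder (Option A) (optionLt r D) where
  trichotomous := by
    rintro (_ | a) (_ | b) <;> simp only [optionLt] <;> try tauto
    intro h1 h2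
    rcases trichotomous_of r a b with h | h | h <;> simp_all
  irrefl := by
    rintro (_ | a) <;> simp only [optionLt]
    · tauto
    · exact irrefl_of r a
  trans := by
    rintro (_ | a) (_ | b) (_ | c) <;> simp only [optionLt] <;> try tauto
    · intro h1 h2
      rcases trichotomous_of r a c with h | h | h
      · exact h
      · subst h; exact absurd h1 h2
      · exact absurd (hD _ _ h h1) h2
    · exact trans_of r

/-- The structure with the given interpretations of the relation symbols. -/
abbrev nOrderStructure {n : ℕ} {A : Type*} (r : Fin n → A → A → Prop) :
    (nOrderLang n).Structure A where
  funMap := fun f _ => f.elim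
  RelMap := fun s v => match s, v with
    | .lt i, v => r i (v 0) (v 1)

instance (n : ℕ) : (nOrderLang n).IsRelational := fun _ => (inferInstance : IsEmpty Empty)

theorem nLt_embedding_iff {n : ℕ} {A B : Type*} [S : (nOrderLang n).Structure A]
    [T : (nOrderLang n).Structure B] (e : A ↪[nOrderLang n] B) (i : Fin n) (x y : A) :
    nLt T i (e x) (e y) ↔ nLt S i x y := by
  have := e.map_rel (NOrderRel.lt i) ![x, y]
  have h : e ∘ ![x, y] = ![e x, e y] := by ext j; fin_cases j <;> rfl
  rwa [h] at this

theorem nLt_equiv_iff {n : ℕ} {A B : Type*} [S : (nOrderLang n).Structure A]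
    [T : (nOrderLang n).Structure B] (e : A ≃[nOrderLang n] B) (i : Fin n) (x y : A) :
    nLt T i (e x) (e y) ↔ nLt S i x y :=
  nLt_embedding_iff e.toEmbedding i x y

section

variable {n : ℕ} {M : Type w} [S : (nOrderLang n).Structure M] [Countable M]

theorem IsUniversalNOrder.isStrictTotalOrder_substructure (hM : IsUniversalNOrder n M)
    (A : (nOrderLang n).Substructure M) [Finite A] (i : Fin n) :
    IsStrictTotalOrder A (fun x y => nLt S i x y) := by
  have h : CategoryTheory.Bundled.mk A ∈ finiteNOrders n := by
    rw [← hM.age]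
    exact FirstOrder.Language.age.fg_substructure
      (FirstOrder.Language.Substructure.fg_iff_finite.2 inferInstance)
  have h2 := h.2 i
  convert h2 using 3 with x y
  exact (nLt_embedding_iff A.subtype i x y)

/-- The substructure carried by a given set. -/
def nOrderSubstructure (s : Set M) : (nOrderLang n).Substructure M :=
  ⟨s, fun f => f.elim⟩

theorem IsUniversalNOrder.isStrictTotalOrder (hM : IsUniversalNOrder n M) (i : Fin n) :
    IsStrictTotalOrder M (nLt S i) := by
  have key : ∀ x y z : M, ∃ A : (nOrderLang n).Substructure M,
      x ∈ A ∧ y ∈ A ∧ z ∈ A ∧ IsStrictTotalOrder A (fun x y => nLt S i x y) := fun x y z => by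
    let A : (nOrderLang n).Substructure M := nOrderSubstructure {x, y, z}
    have : Finite A := Set.toFinite ({x, y, z} : Set M)
    exact ⟨A, Or.inl rfl, Or.inr (Or.inl rfl), Or.inr (Or.inr rfl),
      hM.isStrictTotalOrder_substructure A i⟩
  refine { trichotomous := fun x y h1 h2 => ?_, irrefl := fun x => ?_, trans := fun x y z => ?_ }
  · obtain ⟨A, hx, hy, -, h⟩ := key x y y
    have := h.trichotomous ⟨x, hx⟩ ⟨y, hy⟩ h1 h2
    simpa using this
  · obtain ⟨A, hx, -, -, h⟩ := key x x x
    exact h.irrefl ⟨x, hx⟩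
  · obtain ⟨A, hx, hy, hz, h⟩ := key x y z
    exact h.trans ⟨x, hx⟩ ⟨y, hy⟩ ⟨z, hz⟩

/-- The one-point extension of the finite substructure `s` by these cuts is again a finite
`n`-order, so it lies in the age; ultrahomogeneity realises the new point over `s` itself. -/
theorem IsUniversalNOrder.exists_extension (hM : IsUniversalNOrder n M) (s : Set M)
    (hs : s.Finite) (D : Fin n → Set M) (hD : ∀ i a b, nLt S i a b → b ∈ D i → a ∈ D i) :
    ∃ x, ∀ i, ∀ a ∈ s, (a ∈ D i → nLt S i a x) ∧ (a ∉ D i → nLt S i x a) := by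
  let A : (nOrderLang n).Substructure M := nOrderSubstructure s
  have hA : Finite A := hs
  let T : (nOrderLang n).Structure (Option A) :=
    nOrderStructure fun i => optionLt (fun x y : A => nLt S i x y) {a | (a : M) ∈ D i}
  have hT : ∀ i x y, nLt T i x y ↔
      optionLt (fun x y : A => nLt S i x y) {a | (a : M) ∈ D i} x y := fun i x y => Iff.rfl
  have hage : CategoryTheory.Bundled.mk (Option A) ∈ (nOrderLang n).age M := by
    rw [hM.age]
    refine ⟨(inferInstance : Finite (Option A)), fun i => ?_⟩
    have := hM.isStrictTotalOrder_substructure A i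
    exact isStrictTotalOrder_optionLt _ _ fun a b h hb => hD i a b h hb
  have hne := hage.2
  let g : A ↪[nOrderLang n] Option A :=
    { toFun := some
      inj' := Option.some_injective _
      map_fun' := fun f => f.elim
      map_rel' := by
        rintro _ ⟨i⟩ v
        have : v = ![v 0, v 1] := by ext j; fin_cases j <;> rfl
        rw [this]
        exact (nLt_embedding_iff A.subtype i (v 0) (v 1)) }
  obtain ⟨f, hf⟩ := hM.ultrahomogeneous.extend_embedding (T := Option A)
    (FirstOrder.Language.Structure.fg_iff_finite.2 hA) (h := hne) A.subtype g
  have hfa : ∀ a : A, f (some a) = a := fun a => by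
    have := DFunLike.congr_fun hf a
    exact this.symm
  refine ⟨f none, fun i a ha => ⟨fun h => ?_, fun h => ?_⟩⟩
  · have := (nLt_embedding_iff f i (some ⟨a, ha⟩) none).2 h
    rwa [hfa] at this
  · have := (nLt_embedding_iff f i none (some ⟨a, ha⟩)).2 h
    rwa [hfa] at this

theorem IsUniversalNOrder.isGenericOrderFamily (hM : IsUniversalNOrder n M) :
    IsGenericOrderFamily (nLt S) where
  strictTotal := hM.isStrictTotalOrder
  exists_gt i x := by
    obtain ⟨y, hy⟩ := hM.exists_extension {x} (Set.finite_singleton x) (fun _ => Set.univ)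
      (fun _ _ _ _ _ => trivial)
    exact ⟨y, (hy i x rfl).1 trivial⟩
  exists_lt i x := by
    obtain ⟨y, hy⟩ := hM.exists_extension {x} (Set.finite_singleton x) (fun _ => ∅)
      (fun _ _ _ _ h => h)
    exact ⟨y, (hy i x rfl).2 id⟩
  between a b hab := by
    have hS := hM.isStrictTotalOrder
    -- The cut in order `i` consists of the points up to and including `a i`; it excludes `b i`.
    obtain ⟨y, hy⟩ := hM.exists_extension (Set.range a ∪ Set.range b)
      ((Set.finite_range a).union (Set.finite_range b)) (fun i => {z | ¬ nLt S i (a i) z})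
      (fun i c d hcd hd hc => hd (trans_of (nLt S i) hc hcd))
    refine ⟨y, fun i => ⟨?_, ?_⟩⟩
    · exact (hy i (a i) (Or.inl ⟨i, rfl⟩)).1 (irrefl_of (nLt S i) (a i))
    · exact (hy i (b i) (Or.inr ⟨i, rfl⟩)).2 (fun h => h (hab i))

end

/-! ### Points in prescribed intervals and label classes -/

section LinearOrder

/-- Only bounds inside `C` matter: since `C` is convex, a bound outside it that some point of `C`
satisfies is satisfied by all of `C`. -/
theorem exists_lt_between_finsets {X : Type*} [LinearOrder X] [DenselyOrdered X] {C : Set X}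
    (hne : C.Nonempty) (hC : C.OrdConnected) (hgt : ∀ a ∈ C, ∃ b ∈ C, a < b)
    (hlt : ∀ a ∈ C, ∃ b ∈ C, b < a) (lo hi : Finset X) (hlohi : ∀ l ∈ lo, ∀ h ∈ hi, l < h)
    (hlo : ∀ l ∈ lo, ∃ c ∈ C, l < c) (hhi : ∀ h ∈ hi, ∃ c ∈ C, c < h) :
    ∃ a ∈ C, ∃ b ∈ C, a < b ∧ (∀ l ∈ lo, l < a) ∧ ∀ h ∈ hi, b < h := by
  classical
  have : Nonempty C := hne.to_subtype
  have : NoMaxOrder C := ⟨fun a => let ⟨b, hb, h⟩ := hgt a a.2; ⟨⟨b, hb⟩, h⟩⟩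
  have : NoMinOrder C := ⟨fun a => let ⟨b, hb, h⟩ := hlt a a.2; ⟨⟨b, hb⟩, h⟩⟩
  have hlo' : ∀ l ∈ lo, ∀ a : C, (∀ m ∈ lo.subtype (· ∈ C), m < a) → l < a := by
    intro l hl a ha
    by_contra hal
    obtain ⟨c, hc, hlc⟩ := hlo l hl
    have hlC : l ∈ C := hC.out a.2 hc ⟨not_lt.1 hal, hlc.le⟩
    exact hal (ha ⟨l, hlC⟩ (by simpa using hl))
  have hhi' : ∀ h ∈ hi, ∀ a : C, (∀ m ∈ hi.subtype (· ∈ C), a < m) → a < h := by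
    intro h hh a ha
    by_contra hal
    obtain ⟨c, hc, hlc⟩ := hhi h hh
    have hlC : h ∈ C := hC.out hc a.2 ⟨hlc.le, not_lt.1 hal⟩
    exact hal (ha ⟨h, hlC⟩ (by simpa using hh))
  obtain ⟨a, ha1, ha2⟩ := Order.exists_between_finsets (lo.subtype (· ∈ C)) (hi.subtype (· ∈ C))
    (fun x hx y hy => hlohi x (by simpa using hx) y (by simpa using hy))
  obtain ⟨b, hb1, hb2⟩ := Order.exists_between_finsets {a} (hi.subtype (· ∈ C))
    (fun x hx y hy => by rw [Finset.mem_singleton.1 hx]; exact ha2 y hy)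
  exact ⟨a, a.2, b, b.2, hb1 a (Finset.mem_singleton_self a), fun l hl => hlo' l hl a ha1,
    fun h hh => hhi' h hh b hb2⟩

end LinearOrder

/-- A weakly monotone map to the integers whose fibres have no endpoints. -/
structure IsOpenLabelling {M : Type*} (lt : M → M → Prop) (v : M → ℤ) : Prop where
  mono : ∀ x y, lt x y → v x ≤ v y
  exists_gt : ∀ x, ∃ y, v y = v x ∧ lt x y
  exists_lt : ∀ x, ∃ y, v y = v x ∧ lt y x

namespace IsGenericOrderFamily

variable {n : ℕ} {M : Type w} {lt : Fin n → M → M → Prop}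

theorem flip (h : IsGenericOrderFamily lt) : IsGenericOrderFamily fun i x y => lt i y x where
  strictTotal i := by
    have := h.strictTotal i
    exact inferInstanceAs (IsStrictTotalOrder M (Function.swap (lt i)))
  exists_gt := h.exists_lt
  exists_lt := h.exists_gt
  between a b hab := let ⟨x, hx⟩ := h.between b a hab; ⟨x, fun i => (hx i).symm⟩

theorem irrefl (h : IsGenericOrderFamily lt) (i : Fin n) (x : M) : ¬ lt i x x :=
  (h.strictTotal i).irrefl x

theorem trans (h : IsGenericOrderFamily lt) {i : Fin n} {x y z : M} (hxy : lt i x y)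
    (hyz : lt i y z) : lt i x z :=
  (h.strictTotal i).trans x y z hxy hyz

theorem asymm (h : IsGenericOrderFamily lt) {i : Fin n} {x y : M} (hxy : lt i x y) : ¬ lt i y x :=
  fun hyx => h.irrefl i x (h.trans hxy hyx)

theorem lt_or_gt (h : IsGenericOrderFamily lt) (i : Fin n) {x y : M} (hxy : x ≠ y) :
    lt i x y ∨ lt i y x := by
  have := (h.strictTotal i).trichotomous x y
  tauto

theorem exists_between (h : IsGenericOrderFamily lt) (i : Fin n) {x y : M} (hxy : lt i x y) :
    ∃ z, lt i x z ∧ lt i z y := by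
  classical
  choose s hs using fun k => h.exists_gt k x
  obtain ⟨z, hz⟩ := h.between (fun _ => x) (Function.update s i y) fun k => by
    by_cases hk : k = i
    · subst hk; simpa using hxy
    · simpa [hk] using hs k
  exact ⟨z, by simpa using hz i⟩

theorem exists_upper_bound [Nonempty M] (h : IsGenericOrderFamily lt) (i : Fin n) (F : Finset M) :
    ∃ z, ∀ x ∈ F, lt i x z := by
  classical
  induction F using Finset.induction_on with
  | empty => exact ⟨Classical.arbitrary M, by simp⟩
  | insert a F _ ih =>
    obtain ⟨z, hz⟩ := ih
    obtain ⟨s, hs⟩ := h.exists_gt i z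
    obtain ⟨t, ht⟩ := h.exists_gt i a
    by_cases haz : lt i a z
    · exact ⟨z, by simpa [haz] using hz⟩
    · refine ⟨t, fun x hx => ?_⟩
      rcases Finset.mem_insert.1 hx with rfl | hx
      · exact ht
      · have hxz := hz x hx
        by_cases hza : a = z
        · subst hza; exact h.trans hxz ht
        · exact h.trans hxz (h.trans ((h.lt_or_gt i hza).resolve_left haz) ht)

/-- Each order separately supplies an interval inside the required fibre and between the bounds;
genericity meets all these intervals at once. -/
theorem exists_mem_between (h : IsGenericOrderFamily lt) (v : Fin n → M → ℤ)
    (hv : ∀ i, IsOpenLabelling (lt i) (v i)) (c : Fin n → ℤ) (hc : ∀ i, ∃ y, v i y = c i)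
    (lo hi : Fin n → Finset M) (hlohi : ∀ i, ∀ l ∈ lo i, ∀ r ∈ hi i, lt i l r)
    (hlo : ∀ i, ∀ l ∈ lo i, ∃ y, v i y = c i ∧ lt i l y)
    (hhi : ∀ i, ∀ r ∈ hi i, ∃ y, v i y = c i ∧ lt i y r) :
    ∃ y, ∀ i, v i y = c i ∧ (∀ l ∈ lo i, lt i l y) ∧ ∀ r ∈ hi i, lt i y r := by
  classical
  have key : ∀ i, ∃ a b, lt i a b ∧ v i a = c i ∧ v i b = c i ∧ (∀ l ∈ lo i, lt i l a) ∧
      ∀ r ∈ hi i, lt i b r := by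
    intro i
    have := h.strictTotal i
    let _ : LinearOrder M := linearOrderOfSTO (lt i)
    have : DenselyOrdered M := ⟨fun _ _ hab => h.exists_between i hab⟩
    have hmono : Monotone (v i) := fun x y hxy => by
      rcases hxy.eq_or_lt with rfl | hxy
      · rfl
      · exact (hv i).mono x y hxy
    obtain ⟨a, ha, b, hb, hab, h1, h2⟩ := exists_lt_between_finsets (C := {y | v i y = c i}) (hc i)
      ⟨fun x hx z hz y hy => le_antisymm ((hmono hy.2).trans_eq hz) (hx.symm.trans_le (hmono hy.1))⟩
      (fun a ha => let ⟨b, hb, hab⟩ := (hv i).exists_gt a; ⟨b, hb.trans ha, hab⟩)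
      (fun a ha => let ⟨b, hb, hab⟩ := (hv i).exists_lt a; ⟨b, hb.trans ha, hab⟩)
      (lo i) (hi i) (hlohi i) (hlo i) (hhi i)
    exact ⟨a, b, hab, ha, hb, h1, h2⟩
  choose a b hab ha hb hla hbr using key
  obtain ⟨y, hy⟩ := h.between a b hab
  refine ⟨y, fun i => ⟨le_antisymm ?_ ?_, fun l hl => h.trans (hla i l hl) (hy i).1,
    fun r hr => h.trans (hy i).2 (hbr i r hr)⟩⟩
  · exact ((hv i).mono _ _ (hy i).2).trans_eq (hb i)
  · exact (ha i).symm.trans_le ((hv i).mono _ _ (hy i).1)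

end IsGenericOrderFamily

/-! ### Labelled back-and-forth -/

/-- A finite set of pairs which preserves the orders `lt i` and takes the labels `u i` to the
labels `v i`. -/
structure IsPartialIso {n : ℕ} {M : Type*} (lt : Fin n → M → M → Prop) (u v : Fin n → M → ℤ)
    (p : Finset (M × M)) : Prop where
  lt_iff : ∀ a ∈ p, ∀ b ∈ p, ∀ i, lt i a.1 b.1 ↔ lt i a.2 b.2
  label : ∀ a ∈ p, ∀ i, u i a.1 = v i a.2

namespace IsPartialIso

variable {n : ℕ} {M : Type w} {lt : Fin n → M → M → Prop} {u v : Fin n → M → ℤ}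
  {p : Finset (M × M)}

theorem empty : IsPartialIso lt u v ∅ := ⟨by simp, by simp⟩

theorem eq_iff [NeZero n] (h : IsGenericOrderFamily lt) (hp : IsPartialIso lt u v p)
    {a b : M × M} (ha : a ∈ p) (hb : b ∈ p) : a.1 = b.1 ↔ a.2 = b.2 := by
  have h1 := hp.lt_iff a ha b hb 0
  have h2 := hp.lt_iff b hb a ha 0
  constructor <;> intro heq <;> by_contra hne <;> rcases h.lt_or_gt 0 hne with hl | hl
  · exact h.irrefl 0 b.1 (heq ▸ h1.2 hl)
  · exact h.irrefl 0 b.1 (heq ▸ h2.2 hl)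
  · exact h.irrefl 0 b.2 (heq ▸ h1.1 hl)
  · exact h.irrefl 0 b.2 (heq ▸ h2.1 hl)

theorem swap [DecidableEq M] (hp : IsPartialIso lt u v p) :
    IsPartialIso lt v u (p.image Prod.swap) := by
  constructor
  · intro a ha b hb i
    obtain ⟨a, ha', rfl⟩ := Finset.mem_image.1 ha
    obtain ⟨b, hb', rfl⟩ := Finset.mem_image.1 hb
    exact (hp.lt_iff a ha' b hb' i).symm
  · intro a ha i
    obtain ⟨a, ha', rfl⟩ := Finset.mem_image.1 ha
    exact (hp.label a ha' i).symm

/-- The sets `lo` and `hi` steer the image `y` beyond what extending the isomorphism demands.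
Compatibility with `p` is a further finite set of bounds, and openness of the fibres leaves room
when a neighbour has the same label. -/
theorem exists_insert [DecidableEq M] (h : IsGenericOrderFamily lt) (hp : IsPartialIso lt u v p)
    (hu : ∀ i, IsOpenLabelling (lt i) (u i)) (hv : ∀ i, IsOpenLabelling (lt i) (v i))
    (x : M) (hx : ∀ a ∈ p, a.1 ≠ x) (hux : ∀ i, ∃ y, v i y = u i x) (lo hi : Fin n → Finset M)
    (hlohi : ∀ i, ∀ l ∈ lo i, ∀ r ∈ hi i, lt i l r)
    (hlo : ∀ i, ∀ l ∈ lo i, ∃ y, v i y = u i x ∧ lt i l y)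
    (hhi : ∀ i, ∀ r ∈ hi i, ∃ y, v i y = u i x ∧ lt i y r)
    (hplo : ∀ i, ∀ l ∈ lo i, ∀ a ∈ p, lt i x a.1 → lt i l a.2)
    (hphi : ∀ i, ∀ r ∈ hi i, ∀ a ∈ p, lt i a.1 x → lt i a.2 r) :
    ∃ y, IsPartialIso lt u v (insert (x, y) p) ∧ (∀ i, ∀ l ∈ lo i, lt i l y) ∧
      ∀ i, ∀ r ∈ hi i, lt i y r := by
  classical
  let lo' : Fin n → Finset M := fun i => lo i ∪ {a ∈ p | lt i a.1 x}.image Prod.snd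
  let hi' : Fin n → Finset M := fun i => hi i ∪ {a ∈ p | lt i x a.1}.image Prod.snd
  have h1 : ∀ i, ∀ l ∈ lo' i, ∀ r ∈ hi' i, lt i l r := by
    intro i l hl r hr
    rcases Finset.mem_union.1 hl with hl | hl <;> rcases Finset.mem_union.1 hr with hr | hr
    · exact hlohi i l hl r hr
    · obtain ⟨a, ha, rfl⟩ := Finset.mem_image.1 hr
      rw [Finset.mem_filter] at ha
      exact hplo i l hl a ha.1 ha.2
    · obtain ⟨a, ha, rfl⟩ := Finset.mem_image.1 hl
      rw [Finset.mem_filter] at ha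
      exact hphi i r hr a ha.1 ha.2
    · obtain ⟨a, ha, rfl⟩ := Finset.mem_image.1 hl
      obtain ⟨b, hb, rfl⟩ := Finset.mem_image.1 hr
      rw [Finset.mem_filter] at ha hb
      exact (hp.lt_iff a ha.1 b hb.1 i).1 (h.trans ha.2 hb.2)
  have h2 : ∀ i, ∀ l ∈ lo' i, ∃ y, v i y = u i x ∧ lt i l y := by
    intro i l hl
    rcases Finset.mem_union.1 hl with hl | hl
    · exact hlo i l hl
    · obtain ⟨a, ha, rfl⟩ := Finset.mem_image.1 hl
      rw [Finset.mem_filter] at ha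
      have hle : v i a.2 ≤ u i x := (hp.label a ha.1 i).symm.trans_le ((hu i).mono _ _ ha.2)
      rcases hle.eq_or_lt with heq | hlt
      · obtain ⟨y, hy, hay⟩ := (hv i).exists_gt a.2
        exact ⟨y, hy.trans heq, hay⟩
      · obtain ⟨y, hy⟩ := hux i
        refine ⟨y, hy, ?_⟩
        have hne : a.2 ≠ y := fun e => by rw [e, hy] at hlt; exact lt_irrefl _ hlt
        refine (h.lt_or_gt i hne).resolve_right fun hya => ?_
        have := (hv i).mono _ _ hya
        omega
  have h3 : ∀ i, ∀ r ∈ hi' i, ∃ y, v i y = u i x ∧ lt i y r := by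
    intro i l hl
    rcases Finset.mem_union.1 hl with hl | hl
    · exact hhi i l hl
    · obtain ⟨a, ha, rfl⟩ := Finset.mem_image.1 hl
      rw [Finset.mem_filter] at ha
      have hle : u i x ≤ v i a.2 := ((hu i).mono _ _ ha.2).trans_eq (hp.label a ha.1 i)
      rcases hle.eq_or_lt with heq | hlt
      · obtain ⟨y, hy, hay⟩ := (hv i).exists_lt a.2
        exact ⟨y, hy.trans heq.symm, hay⟩
      · obtain ⟨y, hy⟩ := hux i
        refine ⟨y, hy, ?_⟩
        have hne : a.2 ≠ y := fun e => by rw [e, hy] at hlt; exact lt_irrefl _ hlt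
        refine (h.lt_or_gt i hne).resolve_left fun hya => ?_
        have := (hv i).mono _ _ hya
        omega
  obtain ⟨y, hy⟩ := h.exists_mem_between v hv (fun i => u i x) hux lo' hi' h1 h2 h3
  have hl : ∀ i, ∀ a ∈ p, lt i a.1 x → lt i a.2 y := fun i a ha hax =>
    (hy i).2.1 _ (Finset.mem_union_right _
      (Finset.mem_image_of_mem _ (Finset.mem_filter.2 ⟨ha, hax⟩)))
  have hr : ∀ i, ∀ a ∈ p, lt i x a.1 → lt i y a.2 := fun i a ha hax =>
    (hy i).2.2 _ (Finset.mem_union_right _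
      (Finset.mem_image_of_mem _ (Finset.mem_filter.2 ⟨ha, hax⟩)))
  refine ⟨y, ⟨?_, ?_⟩, fun i l hl => (hy i).2.1 l (Finset.mem_union_left _ hl),
    fun i r hr => (hy i).2.2 r (Finset.mem_union_left _ hr)⟩
  · intro a ha b hb i
    rcases Finset.mem_insert.1 ha with rfl | ha <;> rcases Finset.mem_insert.1 hb with rfl | hb
    · exact ⟨fun hlt => (h.irrefl _ _ hlt).elim, fun hlt => (h.irrefl _ _ hlt).elim⟩
    · refine ⟨hr i b hb, fun hlt => ?_⟩
      by_contra hn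
      exact h.asymm hlt (hl i b hb ((h.lt_or_gt i (hx b hb)).resolve_right hn))
    · refine ⟨hl i a ha, fun hlt => ?_⟩
      by_contra hn
      exact h.asymm hlt (hr i a ha ((h.lt_or_gt i (hx a ha)).resolve_left hn))
    · exact hp.lt_iff a ha b hb i
  · intro a ha i
    rcases Finset.mem_insert.1 ha with rfl | ha
    · exact (hy i).1.symm
    · exact hp.label a ha i

theorem exists_extend_dom [DecidableEq M] (h : IsGenericOrderFamily lt)
    (hp : IsPartialIso lt u v p) (hu : ∀ i, IsOpenLabelling (lt i) (u i))
    (hv : ∀ i, IsOpenLabelling (lt i) (v i)) (x : M) (hux : ∀ i, ∃ y, v i y = u i x) :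
    ∃ q, p ⊆ q ∧ IsPartialIso lt u v q ∧ ∃ y, (x, y) ∈ q := by
  by_cases hx : ∀ a ∈ p, a.1 ≠ x
  · obtain ⟨y, hy, -⟩ := hp.exists_insert h hu hv x hx hux (fun _ => ∅) (fun _ => ∅) (by simp)
      (by simp) (by simp) (by simp) (by simp)
    exact ⟨_, Finset.subset_insert _ _, hy, y, Finset.mem_insert_self _ _⟩
  · push Not at hx
    obtain ⟨a, ha, rfl⟩ := hx
    exact ⟨p, subset_rfl, hp, a.2, ha⟩

theorem exists_extend_ran [DecidableEq M] (h : IsGenericOrderFamily lt)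
    (hp : IsPartialIso lt u v p) (hu : ∀ i, IsOpenLabelling (lt i) (u i))
    (hv : ∀ i, IsOpenLabelling (lt i) (v i)) (y : M) (hvy : ∀ i, ∃ x, u i x = v i y) :
    ∃ q, p ⊆ q ∧ IsPartialIso lt u v q ∧ ∃ x, (x, y) ∈ q := by
  obtain ⟨q, hpq, hq, x, hx⟩ := hp.swap.exists_extend_dom h hv hu y hvy
  refine ⟨q.image Prod.swap, fun a ha => ?_, hq.swap, x, ?_⟩
  · exact Finset.mem_image.2 ⟨a.swap, hpq (Finset.mem_image_of_mem _ ha), by simp⟩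
  · exact Finset.mem_image.2 ⟨(y, x), hx, rfl⟩

end IsPartialIso

/-- Back-and-forth construction of a permutation preserving the orders, taking labels to labels and
meeting countably many further requirements. -/
theorem IsGenericOrderFamily.exists_perm {n : ℕ} [NeZero n] {M : Type w} [Countable M]
    {lt : Fin n → M → M → Prop} (h : IsGenericOrderFamily lt) {u v : Fin n → M → ℤ}
    (hu : ∀ i, IsOpenLabelling (lt i) (u i)) (hv : ∀ i, IsOpenLabelling (lt i) (v i))
    (huv : ∀ i x, ∃ y, v i y = u i x) (hvu : ∀ i y, ∃ x, u i x = v i y)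
    {ι : Type*} [Countable ι] (D : ι → Finset (M × M) → Prop)
    (hD : ∀ k p, IsPartialIso lt u v p → ∃ q, p ⊆ q ∧ IsPartialIso lt u v q ∧ D k q) :
    ∃ e : Equiv.Perm M, (∀ i x y, lt i (e x) (e y) ↔ lt i x y) ∧ (∀ i x, v i (e x) = u i x) ∧
      ∀ k, ∃ p, D k p ∧ ∀ a ∈ p, e a.1 = a.2 := by
  classical
  have : Encodable (M ⊕ M ⊕ ι) := Encodable.ofCountable _
  let P := {p : Finset (M × M) // IsPartialIso lt u v p}
  let 𝒟 : M ⊕ M ⊕ ι → Order.Cofinal P := fun s => match s with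
    | .inl x => ⟨{p | ∃ y, (x, y) ∈ p.1}, fun p =>
        let ⟨q, hpq, hq, hx⟩ := p.2.exists_extend_dom h hu hv x (fun i => huv i x)
        ⟨⟨q, hq⟩, hx, hpq⟩⟩
    | .inr (.inl y) => ⟨{p | ∃ x, (x, y) ∈ p.1}, fun p =>
        let ⟨q, hpq, hq, hx⟩ := p.2.exists_extend_ran h hu hv y (fun i => hvu i y)
        ⟨⟨q, hq⟩, hx, hpq⟩⟩
    | .inr (.inr k) => ⟨{p | D k p.1}, fun p =>
        let ⟨q, hpq, hq, hx⟩ := hD k p.1 p.2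
        ⟨⟨q, hq⟩, hx, hpq⟩⟩
  let J := Order.idealOfCofinals (⟨∅, IsPartialIso.empty⟩ : P) 𝒟
  have hJ := Order.cofinal_meets_idealOfCofinals (⟨∅, IsPartialIso.empty⟩ : P) 𝒟
  have hjoin : ∀ p ∈ J, ∀ q ∈ J, ∃ r : P, p.1 ⊆ r.1 ∧ q.1 ⊆ r.1 := fun p hp q hq =>
    let ⟨r, _, h1, h2⟩ := J.directed p hp q hq
    ⟨r, h1, h2⟩
  have hdom : ∀ x, ∃ y, ∃ p ∈ J, (x, y) ∈ p.1 := fun x =>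
    let ⟨p, ⟨y, hy⟩, hp⟩ := hJ (.inl x)
    ⟨y, p, hp, hy⟩
  have hran : ∀ y, ∃ x, ∃ p ∈ J, (x, y) ∈ p.1 := fun y =>
    let ⟨p, ⟨x, hx⟩, hp⟩ := hJ (.inr (.inl y))
    ⟨x, p, hp, hx⟩
  choose f pf hpf hf using hdom
  choose g pg hpg hg using hran
  refine ⟨⟨f, g, fun x => ?_, fun y => ?_⟩, fun i x y => ?_, fun i x => ?_, fun k => ?_⟩
  · obtain ⟨r, h1, h2⟩ := hjoin _ (hpg (f x)) _ (hpf x)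
    exact (r.2.eq_iff h (h1 (hg (f x))) (h2 (hf x))).2 rfl
  · obtain ⟨r, h1, h2⟩ := hjoin _ (hpf (g y)) _ (hpg y)
    exact (r.2.eq_iff h (h1 (hf (g y))) (h2 (hg y))).1 rfl
  · obtain ⟨r, h1, h2⟩ := hjoin _ (hpf x) _ (hpf y)
    exact (r.2.lt_iff _ (h1 (hf x)) _ (h2 (hf y)) i).symm
  · exact ((pf x).2.label _ (hf x) i).symm
  · obtain ⟨p, hp, hpJ⟩ := hJ (.inr (.inr k))
    refine ⟨p.1, hp, fun a ha => ?_⟩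
    obtain ⟨r, h1, h2⟩ := hjoin _ (hpf a.1) _ hpJ
    exact (r.2.eq_iff h (h1 (hf a.1)) (h2 ha)).1 rfl

/-! ### Cutting a countable dense order along a partly ascending map -/

section Labelling

variable {X : Type*} [LinearOrder X]

theorem exists_int_sequence [Countable X] [Nonempty X] (f : X → X) (hup : ∀ z, ∃ c, z < c ∧ c < f c)
    (hdown : ∀ z, ∃ c, f c < z ∧ c < f c) :
    ∃ c : ℤ → X, (∀ m, c m < f (c m)) ∧ (∀ m, f (c m) < c (m + 1)) ∧ (∀ x, ∃ m, x < c m) ∧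
      ∀ x, ∃ m, c m < x := by
  obtain ⟨e, he⟩ := exists_surjective_nat X
  choose U hU hU' using hup
  choose D hD hD' using hdown
  -- `a` climbs and `b` descends; each step also passes the next point of an enumeration of `X`,
  -- which makes the sequence unbounded. Index `-(k + 1)` will carry `b k`.
  let a : ℕ → X := fun k => Nat.rec (U (e 0)) (fun k z => U (max (f z) (e (k + 1)))) k
  let b : ℕ → X := fun k => Nat.rec (D (min (a 0) (e 0))) (fun k z => D (min z (e (k + 1)))) k
  have ha : ∀ k, a (k + 1) = U (max (f (a k)) (e (k + 1))) := fun _ => rfl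
  have hb : ∀ k, b (k + 1) = D (min (b k) (e (k + 1))) := fun _ => rfl
  have hb' : ∀ k, b k < f (b k) := by rintro (_ | k) <;> exact hD' _
  refine ⟨fun m => Int.casesOn m a b, ?_, ?_, ?_, ?_⟩
  · rintro (k | k)
    · rcases k with _ | k <;> exact hU' _
    · exact hb' k
  · rintro (k | _ | k)
    · change f (a k) < a (k + 1)
      rw [ha]
      exact (le_max_left _ _).trans_lt (hU _)
    · change f (b 0) < a 0
      exact (hD _).trans_le (min_le_left _ _)
    · change f (b (k + 1)) < b k
      rw [hb]
      exact (hD _).trans_le (min_le_left _ _)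
  · intro x
    obtain ⟨k, rfl⟩ := he x
    refine ⟨.ofNat k, ?_⟩
    rcases k with _ | k
    · exact hU _
    · exact (le_max_right _ _).trans_lt (hU _)
  · intro x
    obtain ⟨k, rfl⟩ := he x
    refine ⟨.negSucc k, (hb' k).trans ?_⟩
    rcases k with _ | k <;> exact (hD _).trans_le (min_le_right _ _)

/-- Label `k` is the interval between the cuts `σ (k - 1)` and `σ k`. No point sits on an irrational
cut, so these intervals cover `X` and have no endpoints. -/
theorem exists_isOpenLabelling_of_strictMono (E : X ≃o ℚ) (σ : ℤ → ℝ) (hσ : StrictMono σ)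
    (hirr : ∀ k, Irrational (σ k)) (hup : ∀ x, ∃ k, (E x : ℝ) < σ k)
    (hdown : ∀ x, ∃ k, σ k < (E x : ℝ)) :
    ∃ l : X → ℤ, IsOpenLabelling (· < ·) l ∧ (∀ k, ∃ x, l x = k) ∧
      ∀ x k, σ (k - 1) < E x → (E x : ℝ) < σ k → l x = k := by
  have hE : ∀ x y, x < y ↔ (E x : ℝ) < E y := fun x y => by simp
  have hex : ∀ x, ∃ k, σ (k - 1) < E x ∧ (E x : ℝ) < σ k := by
    intro x
    obtain ⟨b, hb⟩ := hup x
    obtain ⟨k, hk, hmax⟩ := Int.exists_greatest_of_bdd (P := fun k => σ k < E x)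
      ⟨b, fun z hz => (hσ.lt_iff_lt.1 (hz.trans hb)).le⟩ (hdown x)
    refine ⟨k + 1, by simpa using hk, lt_of_le_of_ne (not_lt.1 fun h => ?_) fun h => ?_⟩
    · have := hmax _ h
      omega
    · exact hirr (k + 1) ⟨E x, h⟩
  choose l hl1 hl2 using hex
  have huniq : ∀ x k, σ (k - 1) < E x → (E x : ℝ) < σ k → l x = k := fun x k h1 h2 => by
    have := hσ.lt_iff_lt.1 (h1.trans (hl2 x))
    have := hσ.lt_iff_lt.1 ((hl1 x).trans h2)
    omega
  refine ⟨l, ⟨fun x y hxy => ?_, fun x => ?_, fun x => ?_⟩, fun k => ?_, huniq⟩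
  · have := hσ.lt_iff_lt.1 ((hl1 x).trans (((hE x y).1 hxy).trans (hl2 y)))
    omega
  · obtain ⟨q, h1, h2⟩ := exists_rat_btwn (hl2 x)
    refine ⟨E.symm q, huniq _ _ ?_ ?_, (hE _ _).2 ?_⟩ <;> rw [E.apply_symm_apply]
    exacts [(hl1 x).trans h1, h2, h1]
  · obtain ⟨q, h1, h2⟩ := exists_rat_btwn (hl1 x)
    refine ⟨E.symm q, huniq _ _ ?_ ?_, (hE _ _).2 ?_⟩ <;> rw [E.apply_symm_apply]
    exacts [h1, h2.trans (hl2 x), h2]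
  · obtain ⟨q, h1, h2⟩ := exists_rat_btwn (hσ (show k - 1 < k by omega))
    refine ⟨E.symm q, huniq _ _ ?_ ?_⟩ <;> rw [E.apply_symm_apply]
    exacts [h1, h2]

theorem exists_isOpenLabelling [Countable X] [Nonempty X] [DenselyOrdered X] [NoMinOrder X]
    [NoMaxOrder X] (f : X → X) (hup : ∀ z, ∃ c, z < c ∧ c < f c)
    (hdown : ∀ z, ∃ c, f c < z ∧ c < f c) :
    ∃ l : X → ℤ, IsOpenLabelling (· < ·) l ∧ (∀ k, ∃ x, l x = k) ∧
      ∀ m, ∃ c, l c = 2 * m ∧ l (f c) = 2 * m + 2 := by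
  obtain ⟨c, hc, hc', hcup, hcdown⟩ := exists_int_sequence f hup hdown
  obtain ⟨E⟩ := Order.iso_of_countable_dense X ℚ
  have hE : ∀ {x y}, x < y → (E x : ℝ) < E y := fun h => by simpa using h
  choose α hα h1 h2 using fun m => exists_irrational_btwn (hE (hc m))
  choose β hβ h3 h4 using fun m => exists_irrational_btwn (h2 m)
  -- Two cuts are placed between `c m` and `f (c m)` and none between `f (c m)` and `c (m + 1)`, so
  -- the label jumps by exactly two under `f`.
  let σ : ℤ → ℝ := fun k => if k % 2 = 0 then α (k / 2) else β (k / 2)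
  have hσ0 : ∀ m, σ (2 * m) = α m := fun m => by simp [σ]
  have hσ1 : ∀ m, σ (2 * m + 1) = β m := fun m => by
    have e2 : (2 * m + 1) / 2 = m := by omega
    simp [σ, e2]
  have hβα : ∀ m, β m < α (m + 1) := fun m => (h4 m).trans ((hE (hc' m)).trans (h1 (m + 1)))
  have hmono : StrictMono σ := strictMono_int_of_lt_succ fun k => by
    obtain ⟨m, rfl | rfl⟩ := Int.even_or_odd' k
    · rw [hσ0, hσ1]; exact h3 m
    · rw [hσ1, show 2 * m + 1 + 1 = 2 * (m + 1) by ring, hσ0]; exact hβα m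
  have hirr : ∀ k, Irrational (σ k) := fun k => by
    obtain ⟨m, rfl | rfl⟩ := Int.even_or_odd' k
    · rw [hσ0]; exact hα m
    · rw [hσ1]; exact hβ m
  obtain ⟨l, hl, hsurj, huniq⟩ := exists_isOpenLabelling_of_strictMono E σ hmono hirr
    (fun x => let ⟨m, hm⟩ := hcup x; ⟨2 * m, by rw [hσ0]; exact (hE hm).trans (h1 m)⟩)
    (fun x => let ⟨m, hm⟩ := hcdown x
      ⟨2 * (m - 1), by
        rw [hσ0]
        refine (h2 (m - 1)).trans ((hE (hc' (m - 1))).trans ?_)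
        rw [sub_add_cancel]; exact hE hm⟩)
  refine ⟨l, hl, hsurj, fun m => ⟨c m, huniq _ _ ?_ ?_, huniq _ _ ?_ ?_⟩⟩
  · rw [show 2 * m - 1 = 2 * (m - 1) + 1 by ring, hσ1]
    refine (h4 (m - 1)).trans ?_
    have := hE (hc' (m - 1))
    rwa [sub_add_cancel] at this
  · rw [hσ0]; exact h1 m
  · rw [show 2 * m + 2 - 1 = 2 * m + 1 by ring, hσ1]; exact h4 m
  · rw [show 2 * m + 2 = 2 * (m + 1) by ring, hσ0]
    exact (hE (hc' m)).trans (h1 (m + 1))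

end Labelling

/-! ### A commutator ascending far out in every order -/

theorem IsGenericOrderFamily.isOpenLabelling_zero {n : ℕ} {M : Type w} {lt : Fin n → M → M → Prop}
    (h : IsGenericOrderFamily lt) (i : Fin n) : IsOpenLabelling (lt i) fun _ => 0 where
  mono _ _ _ := le_rfl
  exists_gt x := let ⟨y, hy⟩ := h.exists_gt i x; ⟨y, rfl, hy⟩
  exists_lt x := let ⟨y, hy⟩ := h.exists_lt i x; ⟨y, rfl, hy⟩

namespace IsPartialIso

variable {n : ℕ} {M : Type w} {lt : Fin n → M → M → Prop} {p : Finset (M × M)}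

theorem exists_extend_above [DecidableEq M] (h : IsGenericOrderFamily lt)
    (hp : IsPartialIso lt (fun _ _ => 0) (fun _ _ => 0) p) (j : Fin n) {a b : M} (hab : a ≠ b)
    (ha : ∀ c ∈ p, lt j c.1 a ∧ lt j c.2 a) (hb : ∀ c ∈ p, lt j c.1 b ∧ lt j c.2 b) :
    ∃ q, p ⊆ q ∧ IsPartialIso lt (fun _ _ => 0) (fun _ _ => 0) q ∧
      ∃ a' b', (a, a') ∈ q ∧ (b, b') ∈ q ∧ lt j a a' ∧ lt j b' b := by
  classical
  have h0 := h.isOpenLabelling_zero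
  obtain ⟨a', hq, hlo, hhi⟩ := hp.exists_insert h h0 h0 a
    (fun c hc hca => h.irrefl j a (hca ▸ (ha c hc).1)) (fun i => ⟨a, rfl⟩)
    -- If `a` lies below `b`, its image is kept below `b`, so that `b` can still be sent below
    -- itself.
    (fun i => if i = j then {a} else ∅) (fun i => if i = j ∧ lt j a b then {b} else ∅)
    (fun i l hl r hr => by
      split_ifs at hl hr with h1 h2 <;> simp_all)
    (fun i l _ => let ⟨y, hy⟩ := h.exists_gt i l; ⟨y, rfl, hy⟩)
    (fun i r _ => let ⟨y, hy⟩ := h.exists_lt i r; ⟨y, rfl, hy⟩)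
    (fun i l hl c hc hac => by
      split_ifs at hl with h1
      · subst h1; exact (h.asymm hac (ha c hc).1).elim
      · simp at hl)
    (fun i r hr c hc hca => by
      split_ifs at hr with h1
      · rw [Finset.mem_singleton.1 hr, h1.1]; exact (hb c hc).2
      · simp at hr)
  have haa' : lt j a a' := hlo j a (by simp)
  have ha'b : lt j a b → lt j a' b := fun hlt => hhi j b (by simp [hlt])
  obtain ⟨b', hq', -, hhi'⟩ := hq.exists_insert h h0 h0 b
    (fun c hc hcb => by
      rcases Finset.mem_insert.1 hc with rfl | hc
      · exact hab hcb
      · exact h.irrefl j b (hcb ▸ (hb c hc).1)) (fun i => ⟨a, rfl⟩)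
    (fun _ => ∅) (fun i => if i = j then {b} else ∅) (by simp) (by simp)
    (fun i r _ => let ⟨y, hy⟩ := h.exists_lt i r; ⟨y, rfl, hy⟩) (by simp)
    (fun i r hr c hc hcb => by
      split_ifs at hr with h1
      · rw [Finset.mem_singleton.1 hr]
        subst h1
        rcases Finset.mem_insert.1 hc with rfl | hc
        · exact ha'b hcb
        · exact (hb c hc).2
      · simp at hr)
  exact ⟨_, (Finset.subset_insert _ _).trans (Finset.subset_insert _ _), hq', a', b',
    Finset.mem_insert_of_mem (Finset.mem_insert_self _ _), Finset.mem_insert_self _ _, haa',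
    hhi' j b (by simp)⟩

theorem flip {u v : Fin n → M → ℤ} (hp : IsPartialIso lt u v p) :
    IsPartialIso (fun i x y => lt i y x) u v p where
  lt_iff a ha b hb i := hp.lt_iff b hb a ha i
  label := hp.label

end IsPartialIso

theorem perm_apply_inv_self {M : Type*} (e : Equiv.Perm M) (x : M) : e (e⁻¹ x) = x :=
  e.apply_symm_apply x

theorem perm_inv_apply_self {M : Type*} (e : Equiv.Perm M) (x : M) : e⁻¹ (e x) = x :=
  e.symm_apply_apply x

/-- The permutation preserves all the orders `lt i`. -/
def PreservesOrders {n : ℕ} {M : Type*} (lt : Fin n → M → M → Prop) (e : Equiv.Perm M) : Prop :=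
  ∀ i x y, lt i (e x) (e y) ↔ lt i x y

theorem PreservesOrders.inv {n : ℕ} {M : Type*} {lt : Fin n → M → M → Prop} {e : Equiv.Perm M}
    (he : PreservesOrders lt e) : PreservesOrders lt e⁻¹ := fun i x y => by
  rw [← he i, perm_apply_inv_self, perm_apply_inv_self]

theorem PreservesOrders.mul {n : ℕ} {M : Type*} {lt : Fin n → M → M → Prop} {e f : Equiv.Perm M}
    (he : PreservesOrders lt e) (hf : PreservesOrders lt f) : PreservesOrders lt (e * f) :=
  fun i x y => (he i _ _).trans (hf i x y)

namespace IsGenericOrderFamily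

variable {n : ℕ} {M : Type w} {lt : Fin n → M → M → Prop}

/-- An order `i ≠ j` guarantees that `x` is moved, by placing it strictly between some `a` and `g
a`; order `j` is then free to put `x` far up. -/
theorem exists_ne_above (hn : 2 ≤ n) (h : IsGenericOrderFamily lt) {g : Equiv.Perm M}
    (hg : PreservesOrders lt g) (hg1 : g ≠ 1) (j : Fin n) (F : Finset M) :
    ∃ x, g x ≠ x ∧ ∀ z ∈ F, lt j z x ∧ lt j z (g x) := by
  classical
  obtain ⟨a, ha⟩ : ∃ a, g a ≠ a := by
    by_contra hcon
    push Not at hcon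
    exact hg1 (Equiv.ext hcon)
  have : Nonempty M := ⟨a⟩
  have : Nontrivial (Fin n) := Fin.nontrivial_iff_two_le.2 hn
  obtain ⟨i, hij⟩ := exists_ne j
  -- Bounding `g⁻¹ F` as well puts `g x` above `F`.
  obtain ⟨z, hz⟩ := h.exists_upper_bound j (F ∪ F.image ⇑g⁻¹)
  choose up hup using fun k => h.exists_gt k
  obtain ⟨b, c, hbc, hne⟩ : ∃ b c, lt i b c ∧ ∀ x, lt i b x → lt i x c → g x ≠ x := by
    rcases h.lt_or_gt i ha with hlt | hlt
    · exact ⟨g a, a, hlt, fun x h1 h2 hx => h.asymm h1 (hx ▸ (hg i _ _).2 h2)⟩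
    · exact ⟨a, g a, hlt, fun x h1 h2 hx => h.asymm h2 (hx ▸ (hg i _ _).2 h1)⟩
  obtain ⟨x, hx⟩ := h.between (fun k => if k = i then b else z)
    (fun k => if k = i then c else up k z) (fun k => by
      split_ifs with hk
      · rw [hk]; exact hbc
      · exact hup k z)
  have hxi := hx i
  have hxj := (hx j).1
  rw [if_pos rfl, if_pos rfl] at hxi
  rw [if_neg hij.symm] at hxj
  refine ⟨x, hne x hxi.1 hxi.2, fun y hy => ⟨h.trans (hz y (Finset.mem_union_left _ hy)) hxj, ?_⟩⟩
  have := h.trans (hz _ (Finset.mem_union_right _ (Finset.mem_image_of_mem _ hy))) hxj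
  rwa [← hg j, perm_apply_inv_self] at this

theorem exists_extend_far [DecidableEq M] (hn : 2 ≤ n) (h : IsGenericOrderFamily lt)
    {g : Equiv.Perm M} (hg : PreservesOrders lt g) (hg1 : g ≠ 1) (j : Fin n) (z : M)
    {p : Finset (M × M)} (hp : IsPartialIso lt (fun _ _ => 0) (fun _ _ => 0) p) :
    ∃ q, p ⊆ q ∧ IsPartialIso lt (fun _ _ => 0) (fun _ _ => 0) q ∧
      ∃ x x' y', (x, x') ∈ q ∧ (g x, y') ∈ q ∧ lt j z x ∧ lt j z (g x) ∧ lt j x' x ∧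
        lt j (g x) y' := by
  obtain ⟨x, hx, hF⟩ := h.exists_ne_above hn hg hg1 j
    (insert z (p.image Prod.fst ∪ p.image Prod.snd))
  have h1 : ∀ c ∈ p, c.1 ∈ insert z (p.image Prod.fst ∪ p.image Prod.snd) := fun c hc =>
    Finset.mem_insert_of_mem (Finset.mem_union_left _ (Finset.mem_image_of_mem _ hc))
  have h2 : ∀ c ∈ p, c.2 ∈ insert z (p.image Prod.fst ∪ p.image Prod.snd) := fun c hc =>
    Finset.mem_insert_of_mem (Finset.mem_union_right _ (Finset.mem_image_of_mem _ hc))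
  -- Here `g x` is the point sent up and `x` the one sent down.
  obtain ⟨q, hpq, hq, y', x', hy, hx', hlt, hlt'⟩ := hp.exists_extend_above h j hx
    (fun c hc => ⟨(hF _ (h1 c hc)).2, (hF _ (h2 c hc)).2⟩)
    (fun c hc => ⟨(hF _ (h1 c hc)).1, (hF _ (h2 c hc)).1⟩)
  have hz := hF z (Finset.mem_insert_self _ _)
  exact ⟨q, hpq, hq, x, x', y', hx', hy, hz.1, hz.2, hlt', hlt⟩

theorem exists_perm_far [Countable M] (hn : 2 ≤ n) (h : IsGenericOrderFamily lt)
    {g : Equiv.Perm M} (hg : PreservesOrders lt g) (hg1 : g ≠ 1) :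
    ∃ k : Equiv.Perm M, PreservesOrders lt k ∧ ∀ j z,
      (∃ x, lt j z (g x) ∧ lt j (k x) x ∧ lt j (g x) (k (g x))) ∧
      ∃ x, lt j (g x) z ∧ lt j (k x) x ∧ lt j (g x) (k (g x)) := by
  classical
  have : NeZero n := ⟨by omega⟩
  have h0 := h.isOpenLabelling_zero
  have hginv1 : g⁻¹ ≠ 1 := inv_ne_one.2 hg1
  have hginv : PreservesOrders (fun i x y => lt i y x) g⁻¹ := fun i x y => hg.inv i y x
  obtain ⟨k, hk, -, hD⟩ := h.exists_perm h0 h0 (fun _ x => ⟨x, rfl⟩) (fun _ x => ⟨x, rfl⟩)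
    (ι := (Fin n × M) × Bool) (fun s p => ∃ x x' y', (x, x') ∈ p ∧ (g x, y') ∈ p ∧
      (if s.2 then lt s.1.1 s.1.2 (g x) else lt s.1.1 (g x) s.1.2) ∧ lt s.1.1 x' x ∧
        lt s.1.1 (g x) y') (by
    rintro ⟨⟨j, z⟩, _ | _⟩ p hp
    -- The lower end follows by reversing all orders and replacing `g` by `g⁻¹`: the point sent down
    -- is now `g⁻¹ x`, and its `g`-image `x` is sent up.
    · obtain ⟨q, hpq, hq, x, x', y', hx, hy, h1, -, h3, h4⟩ :=
        h.flip.exists_extend_far hn hginv hginv1 j z hp.flip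
      exact ⟨q, hpq, hq.flip, g⁻¹ x, y', x', hy, by simpa using hx, by simpa using h1, h4,
        by simpa using h3⟩
    · obtain ⟨q, hpq, hq, x, x', y', hx, hy, -, h2, h3, h4⟩ :=
        h.exists_extend_far hn hg hg1 j z hp
      exact ⟨q, hpq, hq, x, x', y', hx, hy, by simpa using h2, h3, h4⟩)
  refine ⟨k, hk, fun j z => ⟨?_, ?_⟩⟩
  · obtain ⟨p, ⟨x, x', y', hx, hy, h1, h2, h3⟩, hp⟩ := hD ((j, z), true)
    refine ⟨x, by simpa using h1, ?_, ?_⟩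
    · rw [hp _ hx]; exact h2
    · rw [hp _ hy]; exact h3
  · obtain ⟨p, ⟨x, x', y', hx, hy, h1, h2, h3⟩, hp⟩ := hD ((j, z), false)
    refine ⟨x, by simpa using h1, ?_, ?_⟩
    · rw [hp _ hx]; exact h2
    · rw [hp _ hy]; exact h3

/-- A suitable commutator of `g` moves up points arbitrarily far out at both ends of all the
orders. -/
theorem exists_commutator_far [Countable M] (hn : 2 ≤ n) (h : IsGenericOrderFamily lt)
    {g : Equiv.Perm M} (hg : PreservesOrders lt g) (hg1 : g ≠ 1) :
    ∃ k : Equiv.Perm M, PreservesOrders lt k ∧ ∀ j z,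
      (∃ x, lt j z x ∧ lt j x ((g * (k⁻¹ * g⁻¹ * k)) x)) ∧
      ∃ x, lt j x z ∧ lt j x ((g * (k⁻¹ * g⁻¹ * k)) x) := by
  obtain ⟨k, hk, hfar⟩ := h.exists_perm_far hn hg hg1
  have key : ∀ j x, lt j (k x) x → lt j (g x) (k (g x)) →
      lt j (g x) ((g * (k⁻¹ * g⁻¹ * k)) (g x)) := by
    intro j x h1 h2
    have h3 : lt j x (g⁻¹ (k (g x))) := by
      have := (hg.inv j _ _).2 h2
      rwa [perm_inv_apply_self] at this
    have h4 := (hk.inv j _ _).2 (h.trans h1 h3)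
    rw [perm_inv_apply_self] at h4
    exact (hg j _ _).2 h4
  refine ⟨k, hk, fun j z => ⟨?_, ?_⟩⟩
  · obtain ⟨x, h1, h2, h3⟩ := (hfar j z).1
    exact ⟨g x, h1, key j x h2 h3⟩
  · obtain ⟨x, h1, h2, h3⟩ := (hfar j z).2
    exact ⟨g x, h1, key j x h2 h3⟩

/-! ### Interleaving two conjugates into a single orbital -/

theorem exists_labelling [Countable M] [Nonempty M] (h : IsGenericOrderFamily lt)
    {f : Equiv.Perm M} (hf : PreservesOrders lt f) (j : Fin n)
    (hup : ∀ z, ∃ x, lt j z x ∧ lt j x (f x)) (hdown : ∀ z, ∃ x, lt j x z ∧ lt j x (f x)) :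
    ∃ l : M → ℤ, IsOpenLabelling (lt j) l ∧ (∀ k, ∃ x, l x = k) ∧
      ∀ m, ∃ c, l c = 2 * m ∧ l (f c) = 2 * m + 2 := by
  classical
  have := h.strictTotal j
  let _ : LinearOrder M := linearOrderOfSTO (lt j)
  have : DenselyOrdered M := ⟨fun _ _ hab => h.exists_between j hab⟩
  have : NoMaxOrder M := ⟨h.exists_gt j⟩
  have : NoMinOrder M := ⟨h.exists_lt j⟩
  refine exists_isOpenLabelling f hup fun z => ?_
  -- Starting below `f⁻¹ z` puts the image `f x` below `z`.
  obtain ⟨x, h1, h2⟩ := hdown (f⁻¹ z)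
  refine ⟨x, ?_, h2⟩
  have := (hf j _ _).2 h1
  rwa [perm_apply_inv_self] at this

/-- By monotonicity `f ^ i` takes `a m` at least to `a (m + i)`, so iterates pass every point and
`f` has no barrier. -/
theorem hasSinglePlusOrbital (h : IsGenericOrderFamily lt) {f : Equiv.Perm M}
    (hf : PreservesOrders lt f) (j : Fin n) (a : ℤ → M) (ha : ∀ m, lt j (a (m + 1)) (f (a m)))
    (hup : ∀ x, ∃ k, ∀ m, k ≤ m → lt j x (a m)) (hdown : ∀ x, ∃ k, ∀ m, m ≤ k → lt j (a m) x) :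
    HasSinglePlusOrbital (lt j) f := by
  have hpow : ∀ (i : ℕ) m, a (m + i) = (f ^ i) (a m) ∨ lt j (a (m + i)) ((f ^ i) (a m)) := by
    intro i
    induction i with
    | zero => intro m; left; simp
    | succ i ih =>
      intro m
      right
      have h1 : lt j (a (m + i + 1)) (f (a (m + i))) := ha _
      rw [pow_succ', Equiv.Perm.mul_apply, Nat.cast_succ, ← add_assoc]
      rcases ih m with heq | hlt
      · rwa [← heq]
      · exact h.trans h1 ((hf j _ _).2 hlt)
  have hpowlt : ∀ x m (i : ℕ), lt j x (a (m + i)) → lt j x ((f ^ i) (a m)) := by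
    intro x m i hx
    rcases hpow i m with heq | hlt
    · rwa [← heq]
    · exact h.trans hx hlt
  have hpres : ∀ i : ℕ, PreservesOrders lt (f ^ i) := by
    intro i
    induction i with
    | zero => exact fun _ _ _ => Iff.rfl
    | succ i ih => rw [pow_succ]; exact ih.mul hf
  refine ⟨a 0, fun x => ?_, fun x => ?_, fun b _ => ?_⟩
  · obtain ⟨k, hk⟩ := hup x
    refine ⟨(k.toNat : ℤ), ?_⟩
    rw [zpow_natCast]
    exact hpowlt x 0 _ (hk _ (by omega))
  · obtain ⟨k, hk⟩ := hdown x
    refine ⟨-((-k).toNat : ℤ), ?_⟩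
    rw [zpow_neg, zpow_natCast, ← hpres (-k).toNat, perm_apply_inv_self]
    have hle : lt j (a (-((-k).toNat : ℤ))) x := hk _ (by omega)
    have h1 := (hpres (-k).toNat j _ _).2 hle
    have h2 := hpow (-k).toNat (-((-k).toNat : ℤ))
    rw [neg_add_cancel] at h2
    rcases h2 with heq | hlt
    · rwa [heq]
    · exact h.trans hlt h1
  -- If `f b ≤ b`, no iterate carries anything below `b` above `b`; but iterates of a term `a k`
  -- below `b` do get above it.
  · by_contra hb
    have hle : ∀ i : ℕ, (f ^ i) b = b ∨ lt j ((f ^ i) b) b := by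
      intro i
      induction i with
      | zero => left; rfl
      | succ i ih =>
        rw [pow_succ', Equiv.Perm.mul_apply]
        have h1 : f b = b ∨ lt j (f b) b := by
          by_cases hfb : f b = b
          · exact Or.inl hfb
          · exact Or.inr ((h.lt_or_gt j hfb).resolve_right hb)
        rcases ih with heq | hlt
        · rwa [heq]
        · have h2 := (hf j _ _).2 hlt
          rcases h1 with heq | h1
          · rw [heq] at h2; exact Or.inr h2
          · exact Or.inr (h.trans h2 h1)
    obtain ⟨k, hk⟩ := hdown b
    obtain ⟨r, hr⟩ := hup b
    have h1 := hpowlt b k (r - k).toNat (hr _ (by omega))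
    have h2 := h.trans h1 ((hpres (r - k).toNat j _ _).2 (hk k le_rfl))
    rcases hle (r - k).toNat with heq | hlt
    · rw [heq] at h2; exact h.irrefl j _ h2
    · exact h.asymm hlt h2

theorem exists_mul_conj_hasSinglePlusOrbital [NeZero n] [Countable M] [Nonempty M]
    (h : IsGenericOrderFamily lt) {f : Equiv.Perm M} (hf : PreservesOrders lt f)
    (hfar : ∀ j z, (∃ x, lt j z x ∧ lt j x (f x)) ∧ ∃ x, lt j x z ∧ lt j x (f x)) :
    ∃ e : Equiv.Perm M, PreservesOrders lt e ∧
      ∀ j, HasSinglePlusOrbital (lt j) (f * (e * f * e⁻¹)) := by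
  choose l hl hsurj hc using fun j => h.exists_labelling hf j (fun z => (hfar j z).1)
    (fun z => (hfar j z).2)
  -- Matching the labels `l + 1` with `l` makes `e` raise every label by one.
  have hl' : ∀ i, IsOpenLabelling (lt i) fun x => l i x + 1 := fun i =>
    ⟨fun x y hxy => by simpa using (hl i).mono x y hxy,
      fun x => by simpa using (hl i).exists_gt x, fun x => by simpa using (hl i).exists_lt x⟩
  obtain ⟨e, hlte, hle, -⟩ := h.exists_perm hl' hl (fun i x => hsurj i _)
    (fun i y => let ⟨x, hx⟩ := hsurj i (l i y - 1); ⟨x, by simp [hx]⟩) (ι := Empty)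
    (fun k => k.elim) (fun k => k.elim)
  have he : PreservesOrders lt e := hlte
  refine ⟨e, he, fun j => ?_⟩
  have hlt : ∀ x y, l j x < l j y → lt j x y := fun x y hxy => by
    refine (h.lt_or_gt j fun hne => ?_).resolve_right fun hyx => ?_
    · rw [hne] at hxy; exact lt_irrefl _ hxy
    · exact absurd ((hl j).mono _ _ hyx) (not_le.2 hxy)
  choose c hc1 hc2 using hc j
  have hce : ∀ m, l j (e (c m)) = 2 * m + 1 := fun m => by rw [hle, hc1]
  refine h.hasSinglePlusOrbital (hf.mul ((he.mul hf).mul he.inv)) j (fun m => e (c m))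
    (fun m => ?_) (fun x => ⟨|l j x|, fun m hm => hlt _ _ ?_⟩)
    -- `e (c m)` has label `2m + 1`; the extra `-1` keeps this below `l j x` even when that is `0`.
    fun x => ⟨-|l j x| - 1, fun m hm => hlt _ _ ?_⟩
  · simp only [Equiv.Perm.mul_apply, perm_inv_apply_self]
    -- Labels: `c (m + 1)` has `2m + 2` and `e (f (c m))` has `2m + 3`. Applying `f` to this pair,
    -- the lower image `f (c (m + 1))` has `2m + 4`, beyond the `2m + 3` of `e (c (m + 1))`.
    have h1 : lt j (c (m + 1)) (e (f (c m))) := hlt _ _ (by rw [hc1, hle, hc2]; omega)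
    exact h.trans (hlt _ (f (c (m + 1))) (by rw [hce, hc2]; omega)) ((hf j _ _).2 h1)
  · rw [hce]
    have := le_abs_self (l j x)
    have := abs_nonneg (l j x)
    omega
  · rw [hce]
    have := neg_abs_le (l j x)
    have := abs_nonneg (l j x)
    omega

end IsGenericOrderFamily

/-! ### Return to automorphisms of the structure -/

/-- A permutation preserving the orders, as an automorphism of the structure. -/
def PreservesOrders.toEquiv {n : ℕ} {M : Type*} [S : (nOrderLang n).Structure M]
    {e : Equiv.Perm M} (he : PreservesOrders (nLt S) e) : M ≃[nOrderLang n] M :=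
  { e with
    map_fun' := fun f => f.elim
    map_rel' := by
      rintro _ ⟨i⟩ v
      have h1 : v = ![v 0, v 1] := by ext j; fin_cases j <;> rfl
      have h2 : e ∘ v = ![e (v 0), e (v 1)] := by ext j; fin_cases j <;> rfl
      have := he i (v 0) (v 1)
      rw [nLt, nLt, ← h1, ← h2] at this
      exact this }

theorem nLt_reverseOrders_empty {n : ℕ} {M : Type*} (S : (nOrderLang n).Structure M) (j : Fin n) :
    nLt (reverseOrders S ∅) j = nLt S j := by
  ext x y
  change (j ∉ (∅ : Set (Fin n)) ∧ nLt S j x y) ∨ (j ∈ (∅ : Set (Fin n)) ∧ nLt S j y x) ↔ _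
  simp

theorem theorem4p6 (n : ℕ) (hn : 2 ≤ n) (M : Type w) [S : (nOrderLang n).Structure M]
    [Countable M] (hM : IsUniversalNOrder n M) (g : M ≃[nOrderLang n] M) (hg : g ≠ 1) :
    ∃ (f : M ≃[nOrderLang n] M) (I : Set (Fin n)), IsProductOfConjugates g f ∧
      ∀ j : Fin n, HasSinglePlusOrbital (nLt (reverseOrders S I) j) f.toEquiv := by
  have h := hM.isGenericOrderFamily
  have : NeZero n := ⟨by omega⟩
  have hgp : PreservesOrders (nLt S) g.toEquiv := fun i x y => nLt_equiv_iff g i x y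
  have hg1 : (g.toEquiv : Equiv.Perm M) ≠ 1 := fun he => hg (by
    ext x
    exact Equiv.congr_fun he x)
  have : Nonempty M := by
    by_contra hne
    rw [not_nonempty_iff] at hne
    exact hg1 (Subsingleton.elim _ _)
  obtain ⟨k, hk, hfar⟩ := h.exists_commutator_far hn hgp hg1
  obtain ⟨e, he, hf⟩ := h.exists_mul_conj_hasSinglePlusOrbital
    (hgp.mul ((hk.inv.mul hgp.inv).mul hk)) hfar
  let k' := hk.toEquiv
  let e' := he.toEquiv
  refine ⟨(g * (k'⁻¹ * g⁻¹ * k')) * (e' * (g * (k'⁻¹ * g⁻¹ * k')) * e'⁻¹), ∅, ?_, fun j => ?_⟩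
  · refine ⟨[g, k'⁻¹ * g⁻¹ * k', e' * g * e'⁻¹, e' * k'⁻¹ * g⁻¹ * (e' * k'⁻¹)⁻¹], ?_, ?_⟩
    · simp only [List.mem_cons, List.not_mem_nil, or_false]
      rintro _ (rfl | rfl | rfl | rfl)
      exacts [⟨1, by simp⟩, ⟨k'⁻¹, by simp⟩, ⟨e', by simp⟩, ⟨e' * k'⁻¹, by simp⟩]
    · simp only [List.prod_cons, List.prod_nil]
      group
  · rw [nLt_reverseOrders_empty]
    exact hf j
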